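/- Let $\kappa$ be an uncountable cardinal with $\kappa^{<\kappa}=\kappa$. Give $2^\kappa$ the topology generated by the sets $N_p=\{\eta\in 2^\kappa : \eta\restriction\alpha=p\}$, $\alpha<\kappa$, $p\in 2^\alpha$; Borel sets are obtained from the open sets by closing under complements and under unions and intersections of length $\le\kappa$, and a function $f:2^\kappa\to 2^\kappa$ is Borel if inverse images of open sets are Borel. For equivalence relations $E,E'$ on $2^\kappa$ write $E\le_B E'$ if there is a Borel function $f:2^\kappa\to 2^\kappa$ such that for all $\eta,\xi\in 2^\kappa$: $\eta\,E\,\xi \iff f(\eta)\,E'\,f(\xi)$. Let $E_0$ be the relation $\{(\eta,\xi) : \{\alpha<\kappa : \eta(\alpha)\ne\xi(\alpha)\}\text{ is bounded in }\kappa\}$. For $S\subset\kappa$ let $(\eta,\xi)\in E_S$ iff $(\eta,\xi)\in E_0$ and for every limit ordinal $\alpha\in S$ there is $\beta<\alpha$ such that either $\eta(\gamma)=\xi(\gamma)$ for all $\gamma\in(\beta,\alpha)$, or $\eta(\gamma)\neq\xi(\gamma)$ for all $\gamma\in(\beta,\alpha)$. Let $\lambda<\kappa$ be an infinite regular cardinal.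 A set $C\subset\kappa$ is $\lambda$-cub if it is unbounded in $\kappa$ and contains the supremum of every strictly increasing sequence of length $\lambda$ of its elements; a set $S\subset\kappa$ is $\lambda$-stationary if it meets every $\lambda$-cub set. For $A\subset\kappa$, in the game $\mathrm{GC}_\lambda(A)$ there are $\lambda$ moves; at move $i<\lambda$ player I picks an ordinal $\alpha_i<\kappa$ greater than all ordinals picked earlier by either player and then player II picks an ordinal $\beta_i<\kappa$ with $\beta_i>\alpha_i$; player II wins if $\sup_{i<\lambda}\alpha_i\in A$, otherwise player I wins. The $\mathrm{GC}_\lambda$-characterization holds for $\kappa$ if, for every $A\subset\kappa$, player II has a winning strategy in $\mathrm{GC}_\lambda(A)$ if and only if $A$ contains a $\lambda$-cub set. Then: if $\lambda<\kappa$ is an infinite regular cardinal, the $\mathrm{GC}_\lambda$-characterization holds for $\kappa$, and $S\subset\kappa$ is $\lambda$-stationary, then $E_0\not\le_B E_S$. In particular, if $S\subset\kappa$ is $\omega$-stationary, then $E_0\not\le_B E_S$ (with no further hypothesis). -/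

import Mathlib

open Set Cardinal

universe u

namespace GenBaire

/-- The set of ordinals below the cardinal `κ`, i.e. `κ` itself as an initial ordinal. -/
abbrev Below (κ : Cardinal.{u}) : Type (u + 1) := Set.Iio κ.ord

/-! ### The generalized Cantor space and its Borel sets -/

/-- The generalized Cantor space `2^κ`: all functions from `κ` to `{0, 1}`. -/
def Cantor (κ : Cardinal.{u}) : Type (u + 1) := Below κ → Bool

/-- The basic open set `N_p = {η | η ↾ α = p}`, for `α < κ` and `p ∈ 2^α`. -/
def basicOpen {κ : Cardinal.{u}} (α : Below κ) (p : Set.Iio α → Bool) : Set (Cantor κ) :=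
  {η | ∀ β : Set.Iio α, η β.1 = p β}

/-- The bounded topology on `2^κ`, generated by the sets `N_p`
(in general not the product topology). -/
instance Cantor.instTopologicalSpace (κ : Cardinal.{u}) : TopologicalSpace (Cantor κ) :=
  TopologicalSpace.generateFrom {N | ∃ (α : Below κ) (p : Set.Iio α → Bool), N = basicOpen α p}

/-- Borel sets of `2^κ`: the closure of the open sets under complements and under unions and
intersections of length at most `κ` (shorter lengths are covered by repeating entries). -/
inductive IsBorel {κ : Cardinal.{u}} : Set (Cantor κ) → Prop
  | of_isOpen (U : Set (Cantor κ)) : IsOpen U → IsBorel U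
  | compl (A : Set (Cantor κ)) : IsBorel A → IsBorel Aᶜ
  | iUnion (A : Below κ → Set (Cantor κ)) : (∀ i, IsBorel (A i)) → IsBorel (⋃ i, A i)
  | iInter (A : Below κ → Set (Cantor κ)) : (∀ i, IsBorel (A i)) → IsBorel (⋂ i, A i)

/-- A function `2^κ → 2^κ` is Borel if inverse images of open sets are Borel. -/
def IsBorelFun {κ : Cardinal.{u}} (f : Cantor κ → Cantor κ) : Prop :=
  ∀ U : Set (Cantor κ), IsOpen U → IsBorel (f ⁻¹' U)

/-- Borel reducibility of an (equivalence) relation `E` on `2^κ` to another one `E'`. -/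
def BorelReducible {κ : Cardinal.{u}} (E E' : Cantor κ → Cantor κ → Prop) : Prop :=
  ∃ f : Cantor κ → Cantor κ, IsBorelFun f ∧ ∀ η ξ : Cantor κ, E η ξ ↔ E' (f η) (f ξ)

/-! ### The equivalence relations -/

/-- `E_0`, equivalence modulo bounded sets: `{α < κ | η(α) ≠ ξ(α)}` is bounded in `κ`. -/
def E0 (κ : Cardinal.{u}) (η ξ : Cantor κ) : Prop :=
  BddAbove {α : Below κ | η α ≠ ξ α}

/-- `E_S^*`: for every limit ordinal `α ∈ S` there is `β < α` such that `η △ ξ` is constant on the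
open interval `(β, α)`. -/
def EStar {κ : Cardinal.{u}} (S : Set (Below κ)) (η ξ : Cantor κ) : Prop :=
  ∀ α ∈ S, Order.IsSuccLimit (α : Ordinal.{u}) →
    ∃ β < α, ∃ b : Bool, ∀ γ : Below κ, β < γ → γ < α → xor (η γ) (ξ γ) = b

/-- `E_S = E_S^* ∩ E_0`. -/
def ES {κ : Cardinal.{u}} (S : Set (Below κ)) (η ξ : Cantor κ) : Prop :=
  EStar S η ξ ∧ E0 κ η ξ

/-! ### `λ`-cub sets, `λ`-stationary sets and cub-games

Below, `lam` is a regular cardinal less than `κ`. -/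

/-- `C ⊆ κ` is `λ`-closed: the supremum of every increasing sequence of elements of `C` of length
`λ` is an element of `C`. -/
def IsLamClosed {κ : Cardinal.{u}} (lam : Cardinal.{u}) (C : Set (Below κ)) : Prop :=
  ∀ c : Below lam → Below κ, StrictMono c → (∀ i, c i ∈ C) → ∃ a ∈ C, IsLUB (Set.range c) a

/-- `C ⊆ κ` is `λ`-cub: `λ`-closed and unbounded in `κ`. -/
def IsLamCub {κ : Cardinal.{u}} (lam : Cardinal.{u}) (C : Set (Below κ)) : Prop :=
  IsLamClosed lam C ∧ ¬ BddAbove C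

/-- `S ⊆ κ` is `λ`-stationary: it meets every `λ`-cub set. -/
def IsLamStationary {κ : Cardinal.{u}} (lam : Cardinal.{u}) (S : Set (Below κ)) : Prop :=
  ∀ C : Set (Below κ), IsLamCub lam C → (S ∩ C).Nonempty

/-- A strategy of player II in the game of length `λ`: from the moves `(α_j)_{j ≤ i}` of player I
and her own earlier moves `(β_j)_{j < i}` it produces the move `β_i`. -/
abbrev Strategy (κ lam : Cardinal.{u}) : Type (u + 1) :=
  (i : Below lam) → (Set.Iic i → Below κ) → (Set.Iio i → Below κ) → Below κ

/-- In the sequence of moves `(α_i, β_i)_{i < λ}` player I always obeys the rules: each `α_i` is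
greater than all ordinals picked earlier. -/
def LegalForI {κ lam : Cardinal.{u}} (α β : Below lam → Below κ) : Prop :=
  ∀ i j : Below lam, j < i → α j < α i ∧ β j < α i

/-- The strategy `σ` of player II is winning in `GC_λ(A)`: in every play in which II follows `σ` and
I obeys the rules, II obeys the rules (`β_i > α_i`) and `sup_{i < λ} α_i` belongs to `A`. -/
def IsWinning {κ lam : Cardinal.{u}} (A : Set (Below κ)) (σ : Strategy κ lam) : Prop :=
  ∀ α β : Below lam → Below κ,
    (∀ i, β i = σ i (fun j => α j.1) (fun j => β j.1)) → LegalForI α β →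
      (∀ i, α i < β i) ∧ ∃ a ∈ A, IsLUB (Set.range α) a

/-- The `GC_λ`-characterization holds for `κ`: player II has a winning strategy in `GC_λ(A)` exactly
for those `A ⊆ κ` that contain a `λ`-cub set. -/
def GCCharacterization (κ lam : Cardinal.{u}) : Prop :=
  {A : Set (Below κ) | ∃ σ : Strategy κ lam, IsWinning A σ} =
    {A : Set (Below κ) | ∃ C : Set (Below κ), IsLamCub lam C ∧ C ⊆ A}

end GenBaire

namespace GenBaire

/-! Let `f` be a Borel reduction of `E0 κ` to `ES S`. It is continuous on a comeager set
(`IsBorelFun.exists_comeager`), which shrinks to an `E0`-invariant comeager set `D` because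
`E0`-classes have at most `κ` elements (`Comeager.setOf_E0_class`). By Baire category, any two basic
open sets contain points of `D` with `E0`-inequivalent images; by invariance they also contain
`E0`-equivalent points of `D`, whose images eventually agree. So every pair of conditions extends to
one forcing the images to differ at one place and to agree at another, both beyond a prescribed
ordinal (`exists_le_splits`).

Player II iterates such extensions and answers with the lengths reached. The limit pair still
contains `E0`-equivalent points of `D`, but the difference of their images is not constant on any
final segment below the supremum, which therefore lies outside `S` (`notMem_of_splits`). Thus II
wins the game for `Sᶜ`, and the characterization yields a `λ`-cub set missing `S`. For `λ = ω`,
closing off under finite positions of the game yields the cub set directly. -/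

/-- König's theorem: a cofinality below `κ` would give `κ < κ ^ cof κ ≤ κ ^< κ`. -/
theorem isRegular_of_powerlt_eq {κ : Cardinal.{u}} (hκ : ℵ₀ < κ) (hpow : κ ^< κ = κ) :
    κ.IsRegular := by
  refine ⟨hκ.le, ?_⟩
  by_contra! h
  exact absurd (le_powerlt κ h) (by rw [hpow]; exact (lt_power_cof_ord hκ.le).not_ge)

/-! ### Ordinals below `κ` and the size of `E0`-classes -/

section Below

variable {κ : Cardinal.{u}}

theorem mk_below (κ : Cardinal.{u}) : #(Below κ) = lift.{u + 1} κ := by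
  simp [Below]

theorem mk_Iio_below (a : Below κ) : #(Iio a) < lift.{u + 1} κ := by
  have h : #(Iio a) ≤ #(Iio (a : Ordinal.{u})) :=
    mk_le_of_injective (f := fun x : Iio a => (⟨x.1.1, x.2⟩ : Iio (a : Ordinal.{u})))
      fun x y hxy => by
        exact Subtype.ext (Subtype.ext (congrArg (fun z : Iio (a : Ordinal.{u}) => (z : Ordinal.{u})) hxy))
  refine h.trans_lt ?_
  rw [mk_Iio_ordinal, lift_lt]
  exact lt_ord.1 a.2

theorem noMaxOrder_below (hκ : ℵ₀ ≤ κ) : NoMaxOrder (Below κ) :=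
  ⟨fun a => ⟨⟨Order.succ a.1, (isSuccLimit_ord hκ).succ_lt a.2⟩, Order.lt_succ a.1⟩⟩

theorem nonempty_below (hκ : ℵ₀ ≤ κ) : Nonempty (Below κ) :=
  ⟨⟨0, (isSuccLimit_ord hκ).bot_lt⟩⟩

/-- Families of fewer than `κ` elements of a regular cardinal `κ` are bounded. -/
theorem bddAbove_range_of_mk_lt (hκ : κ.IsRegular) {ι : Type (u + 1)} (h : #ι < lift.{u + 1} κ)
    (g : ι → Below κ) : BddAbove (range g) := by
  apply BddAbove.of_not_isCofinal
  intro hc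
  have h1 := Order.cof_le hc
  rw [Ordinal.cof_Iio, ← Ordinal.lift_cof, hκ.cof_ord] at h1
  exact absurd h (h1.trans mk_range_le).not_gt

theorem bddAbove_range_nat (hκ : κ.IsRegular) (hω : ℵ₀ < κ) (g : ℕ → Below κ) :
    BddAbove (range g) := by
  have h := bddAbove_range_of_mk_lt hκ (ι := ULift.{u + 1} ℕ) (by simpa using hω)
    (g ∘ ULift.down)
  rwa [ULift.down_surjective.range_comp] at h

theorem exists_isLUB_of_bddAbove {s : Set (Below κ)} (h : BddAbove s) : ∃ a, IsLUB s a := by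
  obtain ⟨a, ha⟩ : ∃ a, Minimal (· ∈ upperBounds s) a := exists_minimal_of_wellFoundedLT _ h
  refine ⟨a, ha.1, fun b hb => ?_⟩
  rcases le_total a b with h | h
  · exact h
  · exact ha.2 hb h

theorem mk_Iio_arrow_bool_le (hpow : κ ^< κ = κ) (hκ : ℵ₀ ≤ κ) (a : Below κ) :
    #(Iio a → Bool) ≤ lift.{u + 1} κ := by
  have h := mk_Iio_below a
  obtain ⟨c, hc⟩ := Cardinal.mem_range_lift_of_le (h.le)
  rw [← hc, lift_lt] at h
  have h2 : #(Iio a → Bool) = 2 ^ #(Iio a) := by simp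
  rw [h2, ← hc, ← Cardinal.lift_two.{u + 1, u}, ← lift_power, Cardinal.lift_le]
  calc 2 ^ c ≤ κ ^ c := power_le_power_right (natCast_lt_aleph0.le.trans hκ)
    _ ≤ κ ^< κ := le_powerlt _ h
    _ = κ := hpow

open Classical in
/-- `E_0`-classes have at most `κ` elements. -/
theorem exists_enum_E0 (hpow : κ ^< κ = κ) (hκ : ℵ₀ ≤ κ) (η : Cantor κ) :
    ∃ r : Below κ → Cantor κ, ∀ ξ, E0 κ η ξ → ∃ i, r i = ξ := by
  have := noMaxOrder_below hκ
  let G : (Σ a : Below κ, Iio a → Bool) → Cantor κ := fun x γ =>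
    if h : γ < x.1 then x.2 ⟨γ, h⟩ else η γ
  have hG : ∀ ξ, E0 κ η ξ → ∃ x, G x = ξ := by
    rintro ξ ⟨b, hb⟩
    obtain ⟨a, ha⟩ := exists_gt b
    refine ⟨⟨a, fun γ => ξ γ⟩, funext fun γ => ?_⟩
    by_cases h : γ < a
    · simp [G, h]
    · by_contra hne
      exact h ((hb (show η γ ≠ ξ γ by simpa [G, h] using hne)).trans_lt ha)
  have hcard : #(Σ a : Below κ, Iio a → Bool) ≤ #(Below κ) := by
    rw [mk_sigma]
    refine (sum_le_sum _ (fun _ => lift.{u + 1} κ) (mk_Iio_arrow_bool_le hpow hκ)).trans ?_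
    rw [sum_const', mk_below, mul_eq_self (by simpa using hκ)]
  obtain ⟨e⟩ := hcard
  have : Nonempty (Σ a : Below κ, Iio a → Bool) :=
    ⟨⟨(nonempty_below hκ).some, fun _ => true⟩⟩
  refine ⟨fun i => G (Function.invFun e i), fun ξ hξ => ?_⟩
  obtain ⟨x, hx⟩ := hG ξ hξ
  exact ⟨e x, by simp only [Function.leftInverse_invFun e.injective x, hx]⟩

end Below

theorem antitone_of_forall_lt {ι P : Type*} [LinearOrder ι] [Preorder P] {s : ι → P}
    (h : ∀ i, ∀ j < i, s i ≤ s j) : Antitone s := by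
  intro i j hij
  rcases hij.eq_or_lt with rfl | hlt
  · exact le_rfl
  · exact h _ _ hlt

/-! ### Descending transfinite sequences -/

section Chain

variable {ι P : Type*} [LinearOrder ι] [WellFoundedLT ι] [Preorder P]

open Classical in
/-- Some `p ≤ p₀` satisfying `Q`, or `p₀` if there is none. -/
noncomputable def chooseBelow (p₀ : P) (Q : P → Prop) : P :=
  if h : ∃ p ≤ p₀, Q p then h.choose else p₀

theorem chooseBelow_spec {p₀ : P} {Q : P → Prop} (h : ∃ p ≤ p₀, Q p) :
    chooseBelow p₀ Q ≤ p₀ ∧ Q (chooseBelow p₀ Q) := by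
  rw [chooseBelow, dif_pos h]
  exact h.choose_spec

/-- The transfinite sequence below `p₀` obtained by applying `F i` at stage `i` to a lower bound of
the earlier stages. -/
noncomputable def chain (p₀ : P) (F : ι → P → P) : ι → P :=
  (wellFounded_lt (α := ι)).fix fun i s =>
    F i (chooseBelow p₀ fun p => ∀ j (hj : j < i), p ≤ s j hj)

theorem chain_eq (p₀ : P) (F : ι → P → P) (i : ι) :
    chain p₀ F i = F i (chooseBelow p₀ fun p => ∀ j < i, p ≤ chain p₀ F j) := by
  rw [chain, WellFounded.fix_eq]

/-- Stage `i` consults only `F j` for `j ≤ i`, so a player who knows the moves up to `i` can compute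
it. -/
theorem chain_congr (p₀ : P) {F G : ι → P → P} (i : ι) (h : ∀ j ≤ i, F j = G j) :
    chain p₀ F i = chain p₀ G i := by
  induction i using WellFoundedLT.induction with
  | ind i ih =>
    have h1 : (fun p => ∀ j < i, p ≤ chain p₀ F j) = fun p => ∀ j < i, p ≤ chain p₀ G j :=
      funext fun p => propext <|
        forall₂_congr fun j hj => by rw [ih j hj fun k hk => h k (hk.trans hj.le)]
    rw [chain_eq, chain_eq, h i le_rfl, h1]

theorem chain_spec {p₀ : P} {F : ι → P → P} (hF : ∀ i p, F i p ≤ p)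
    (hlb : ∀ (i : ι) (s : Iio i → P), Antitone s → (∀ j, s j ≤ p₀) → ∃ p ≤ p₀, ∀ j, p ≤ s j)
    (i : ι) :
    chain p₀ F i ≤ p₀ ∧ (∀ j < i, chain p₀ F i ≤ chain p₀ F j) ∧ ∃ p, chain p₀ F i = F i p := by
  induction i using WellFoundedLT.induction with
  | ind i ih =>
    obtain ⟨p, hp, hp'⟩ := hlb i (fun j => chain p₀ F j.1)
      (fun j k hjk => by
        rcases hjk.eq_or_lt with rfl | hlt
        · exact le_rfl
        · exact (ih k.1 k.2).2.1 j.1 hlt)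
      (fun j => (ih j.1 j.2).1)
    obtain ⟨h1, h2⟩ := chooseBelow_spec (Q := fun p => ∀ j < i, p ≤ chain p₀ F j)
      ⟨p, hp, fun j hj => hp' ⟨j, hj⟩⟩
    have e := chain_eq p₀ F i
    refine ⟨?_, fun j hj => ?_, _, e⟩
    · rw [e]; exact (hF _ _).trans h1
    · rw [e]; exact (hF _ _).trans (h2 j hj)

end Chain

/-! ### Conditions and their limits -/

/-- A condition: the restriction of `val ∈ 2^κ` to `len < κ`. -/
structure Cond (κ : Cardinal.{u}) where
  /-- The length of the condition. -/
  len : Below κ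
  /-- A point extending the condition. -/
  val : Cantor κ

variable {κ : Cardinal.{u}}

/-- Conditions are ordered by reverse end-extension. -/
instance : Preorder (Cond κ) where
  le c d := d.len ≤ c.len ∧ ∀ β < d.len, c.val β = d.val β
  le_refl c := ⟨le_rfl, fun _ _ => rfl⟩
  le_trans c d e h h' :=
    ⟨h'.1.trans h.1, fun β hβ => (h.2 β (hβ.trans_le h'.1)).trans (h'.2 β hβ)⟩

/-- The basic open set given by a condition. -/
def Cond.nbhd (c : Cond κ) : Set (Cantor κ) := {η | ∀ β < c.len, η β = c.val β}

theorem Cond.val_mem_nbhd (c : Cond κ) : c.val ∈ c.nbhd := fun _ _ => rfl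

theorem Cond.nbhd_subset {c d : Cond κ} (h : c ≤ d) : c.nbhd ⊆ d.nbhd := fun _ hη β hβ =>
  (hη β (hβ.trans_le h.1)).trans (h.2 β hβ)

theorem Cond.mk_le {c : Cond κ} {η : Cantor κ} (h : η ∈ c.nbhd) {a : Below κ} (ha : c.len ≤ a) :
    (⟨a, η⟩ : Cond κ) ≤ c := ⟨ha, h⟩

open Classical in
theorem exists_mem_nbhd_of_antitone {ι : Type*} [LinearOrder ι] {s : ι → Cond κ}
    (hs : Antitone s) : ∃ η, ∀ i, η ∈ (s i).nbhd := by
  refine ⟨fun γ => if h : ∃ i, γ < (s i).len then (s h.choose).val γ else true, fun i β hβ => ?_⟩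
  have h : ∃ i, β < (s i).len := ⟨i, hβ⟩
  simp only [dif_pos h]
  rcases le_total i h.choose with hi | hi
  · exact (hs hi).2 β hβ
  · exact ((hs hi).2 β h.choose_spec).symm

theorem exists_le_of_antitone {ι : Type*} [LinearOrder ι] {s : ι → Cond κ} (hs : Antitone s)
    (hb : BddAbove (range fun i => (s i).len)) : ∃ c, ∀ i, c ≤ s i := by
  obtain ⟨η, hη⟩ := exists_mem_nbhd_of_antitone hs
  obtain ⟨a, ha⟩ := hb
  exact ⟨⟨a, η⟩, fun i => Cond.mk_le (hη i) (ha (mem_range_self i))⟩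

theorem exists_pair_le_of_antitone {ι : Type*} [LinearOrder ι] (hb : ∀ g : ι → Below κ,
    BddAbove (range g)) {s : ι → Cond κ × Cond κ} (hs : Antitone s) : ∃ c, ∀ i, c ≤ s i := by
  obtain ⟨c, hc⟩ := exists_le_of_antitone (s := fun i => (s i).1) (fun i j h => (hs h).1) (hb _)
  obtain ⟨d, hd⟩ := exists_le_of_antitone (s := fun i => (s i).2) (fun i j h => (hs h).2) (hb _)
  exact ⟨(c, d), fun i => ⟨hc i, hd i⟩⟩

/-! ### Comeager sets and the Baire property -/

/-- The set contains a dense open set. -/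
def HasDenseInterior (D : Set (Cantor κ)) : Prop := ∀ c : Cond κ, ∃ d ≤ c, d.nbhd ⊆ D

/-- The set contains an intersection of `κ` dense open sets. -/
def Comeager (A : Set (Cantor κ)) : Prop :=
  ∃ D : Below κ → Set (Cantor κ), (∀ i, HasDenseInterior (D i)) ∧ ⋂ i, D i ⊆ A

theorem Comeager.mono {A B : Set (Cantor κ)} (hA : Comeager A) (h : A ⊆ B) : Comeager B :=
  let ⟨D, hD, hDA⟩ := hA
  ⟨D, hD, hDA.trans h⟩

theorem HasDenseInterior.comeager (hκ : ℵ₀ ≤ κ) {D : Set (Cantor κ)} (h : HasDenseInterior D) :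
    Comeager D :=
  ⟨fun _ => D, fun _ => h, iInter_subset _ (nonempty_below hκ).some⟩

theorem Comeager.iInter (hκ : ℵ₀ ≤ κ) {ι : Type (u + 1)} (hι : #ι ≤ lift.{u + 1} κ)
    {A : ι → Set (Cantor κ)} (hA : ∀ i, Comeager (A i)) : Comeager (⋂ i, A i) := by
  rcases isEmpty_or_nonempty ι with he | hne
  · refine ⟨fun _ => univ, fun _ c => ⟨c, le_rfl, subset_univ _⟩, ?_⟩
    simp
  choose D hD hDA using hA
  have hcard : #(ι × Below κ) ≤ #(Below κ) := by
    rw [mk_prod, mk_below, Cardinal.lift_id, Cardinal.lift_id]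
    exact (mul_le_mul_left hι _).trans (mul_eq_self (by simpa using hκ)).le
  obtain ⟨e⟩ := hcard
  have := nonempty_below hκ
  refine ⟨fun i => D (Function.invFun e i).1 (Function.invFun e i).2, fun i => hD _ _, ?_⟩
  intro η hη
  rw [mem_iInter] at hη ⊢
  refine fun i => hDA i (mem_iInter.2 fun j => ?_)
  have := hη (e (i, j))
  rwa [Function.leftInverse_invFun e.injective (i, j)] at this

theorem Comeager.inter (hκ : ℵ₀ ≤ κ) {A B : Set (Cantor κ)} (hA : Comeager A) (hB : Comeager B) :
    Comeager (A ∩ B) := by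
  refine (Comeager.iInter hκ (ι := ULift.{u + 1} Bool) (A := fun b => cond b.down A B) ?_ ?_).mono
    fun η hη => ?_
  · exact (lt_aleph0_of_finite _).le.trans (by simpa using hκ)
  · rintro ⟨_ | _⟩
    · exact hB
    · exact hA
  · rw [mem_iInter] at hη
    exact ⟨hη ⟨true⟩, hη ⟨false⟩⟩

/-- The Baire category theorem: comeager sets are dense. -/
theorem Comeager.exists_mem_nbhd (hκ : κ.IsRegular) {A : Set (Cantor κ)} (hA : Comeager A)
    (c : Cond κ) : ∃ η ∈ A, η ∈ c.nbhd := by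
  obtain ⟨D, hD, hDA⟩ := hA
  choose F hF hFD using hD
  -- Proper initial segments of the `κ`-chain are shorter than `κ`, so by regularity their lengths
  -- are bounded.
  have hspec := chain_spec (p₀ := c) hF (fun i s hs hc => by
    have hb := bddAbove_range_of_mk_lt hκ (mk_Iio_below i)
    obtain ⟨⟨a, η⟩, hd⟩ := exists_le_of_antitone hs (hb _)
    by_cases hne : Nonempty (Iio i)
    · exact ⟨⟨a, η⟩, (hd hne.some).trans (hc hne.some), hd⟩
    · exact ⟨c, le_rfl, fun j => (hne ⟨j⟩).elim⟩)
  obtain ⟨η, hη⟩ := exists_mem_nbhd_of_antitone (antitone_of_forall_lt fun i => (hspec i).2.1)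
  refine ⟨η, hDA (mem_iInter.2 fun i => ?_), ?_⟩
  · obtain ⟨p, hp⟩ := (hspec i).2.2
    exact hFD i p (hp ▸ hη i)
  · exact Cond.nbhd_subset (hspec (nonempty_below hκ.aleph0_le).some).1 (hη _)

theorem IsOpen.exists_nbhd_subset (hκ : ℵ₀ ≤ κ) {U : Set (Cantor κ)} (hU : IsOpen U) :
    ∀ η ∈ U, ∃ a, (⟨a, η⟩ : Cond κ).nbhd ⊆ U := by
  induction hU with
  | basic s hs =>
    obtain ⟨a, p, rfl⟩ := hs
    exact fun η hη => ⟨a, fun ξ hξ β => (hξ β.1 β.2).trans (hη β)⟩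
  | univ => exact fun η _ => ⟨(nonempty_below hκ).some, subset_univ _⟩
  | inter s t _ _ hs ht =>
    rintro η ⟨h1, h2⟩
    obtain ⟨a, ha⟩ := hs η h1
    obtain ⟨b, hb⟩ := ht η h2
    exact ⟨max a b, fun ξ hξ => ⟨ha fun β hβ => hξ β (hβ.trans_le (le_max_left a b)),
      hb fun β hβ => hξ β (hβ.trans_le (le_max_right a b))⟩⟩
  | sUnion S _ ih =>
    rintro η ⟨s, hs, hη⟩
    obtain ⟨a, ha⟩ := ih s hs η hη
    exact ⟨a, ha.trans (subset_sUnion_of_mem hs)⟩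

theorem isOpen_setOf_apply_eq (hκ : ℵ₀ ≤ κ) (γ : Below κ) (b : Bool) :
    IsOpen {η : Cantor κ | η γ = b} := by
  have := noMaxOrder_below hκ
  obtain ⟨a, ha⟩ := exists_gt γ
  have : {η : Cantor κ | η γ = b} =
      ⋃ p : {p : Iio a → Bool // p ⟨γ, ha⟩ = b}, basicOpen a p.1 := by
    ext η
    simp only [mem_ofPred_eq, mem_iUnion, basicOpen]
    exact ⟨fun h => ⟨⟨fun β => η β.1, h⟩, fun β => rfl⟩, fun ⟨p, hp⟩ => (hp ⟨γ, ha⟩).trans p.2⟩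
  rw [this]
  exact isOpen_iUnion fun p => TopologicalSpace.isOpen_generateFrom_of_mem ⟨a, p.1, rfl⟩

/-- Equality to an open set modulo a meager set. -/
def BaireProperty (B : Set (Cantor κ)) : Prop :=
  ∃ U : Set (Cantor κ), (∀ η ∈ U, ∃ a, (⟨a, η⟩ : Cond κ).nbhd ⊆ U) ∧ Comeager {η | η ∈ B ↔ η ∈ U}

theorem BaireProperty.compl (hκ : ℵ₀ ≤ κ) {B : Set (Cantor κ)} (hB : BaireProperty B) :
    BaireProperty Bᶜ := by
  obtain ⟨U, hU, hBU⟩ := hB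
  -- `V` is the interior of `Uᶜ`; what `U ∪ V` misses is the nowhere dense boundary of `U`.
  let V : Set (Cantor κ) := {η | ∃ a, (⟨a, η⟩ : Cond κ).nbhd ⊆ Uᶜ}
  have hV : ∀ η ∈ V, η ∉ U := fun η ⟨a, ha⟩ => ha (Cond.val_mem_nbhd ⟨a, η⟩)
  have hD : HasDenseInterior (U ∪ V) := by
    intro c
    by_cases h : ∃ η ∈ c.nbhd, η ∈ U
    · obtain ⟨η, hη, hηU⟩ := h
      obtain ⟨a, ha⟩ := hU η hηU
      refine ⟨⟨max a c.len, η⟩, Cond.mk_le hη (le_max_right _ _), fun ξ hξ => Or.inl (ha ?_)⟩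
      exact fun β hβ => hξ β (hβ.trans_le (le_max_left a c.len))
    · refine ⟨c, le_rfl, fun ξ hξ => Or.inr ⟨c.len, fun ζ hζ hζU => h ⟨ζ, ?_, hζU⟩⟩⟩
      exact fun β hβ => (hζ β hβ).trans (hξ β hβ)
  refine ⟨V, fun η ⟨a, ha⟩ => ⟨a, fun ξ hξ => ⟨a, fun ζ hζ => ha ?_⟩⟩, ?_⟩
  · exact fun β hβ => (hζ β hβ).trans (hξ β hβ)
  · refine (hBU.inter hκ (hD.comeager hκ)).mono ?_
    rintro η ⟨h1, h2⟩
    simp only [mem_ofPred_eq, mem_compl_iff] at h1 ⊢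
    rw [h1]
    exact ⟨fun h => h2.resolve_left h, hV η⟩

theorem BaireProperty.iUnion (hκ : ℵ₀ ≤ κ) {B : Below κ → Set (Cantor κ)}
    (hB : ∀ i, BaireProperty (B i)) : BaireProperty (⋃ i, B i) := by
  choose U hU hBU using hB
  refine ⟨⋃ i, U i, fun η hη => ?_, ?_⟩
  · obtain ⟨i, hi⟩ := mem_iUnion.1 hη
    obtain ⟨a, ha⟩ := hU i η hi
    exact ⟨a, ha.trans (subset_iUnion U i)⟩
  · refine (Comeager.iInter hκ (mk_below κ).le hBU).mono fun η hη => ?_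
    rw [mem_iInter] at hη
    simp only [mem_ofPred_eq, mem_iUnion]
    exact exists_congr hη

theorem IsBorel.baireProperty (hκ : ℵ₀ ≤ κ) {B : Set (Cantor κ)} (hB : IsBorel B) :
    BaireProperty B := by
  induction hB with
  | of_isOpen U hU =>
    exact ⟨U, IsOpen.exists_nbhd_subset hκ hU, fun _ => univ,
      fun _ c => ⟨c, le_rfl, subset_univ _⟩, fun η _ => Iff.rfl⟩
  | compl A _ ih => exact ih.compl hκ
  | iUnion A _ ih => exact BaireProperty.iUnion hκ ih
  | iInter A _ ih =>
    have := (BaireProperty.iUnion hκ fun i => (ih i).compl hκ).compl hκ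
    rwa [← compl_iInter, compl_compl] at this

/-- Borel functions are continuous on a comeager set. -/
theorem IsBorelFun.exists_comeager (hκ : ℵ₀ ≤ κ) {f : Cantor κ → Cantor κ} (hf : IsBorelFun f) :
    ∃ A : Set (Cantor κ), Comeager A ∧
      ∀ η ∈ A, ∀ γ, ∃ a, ∀ ξ ∈ A, ξ ∈ (⟨a, η⟩ : Cond κ).nbhd → f ξ γ = f η γ := by
  have h : ∀ x : Below κ × ULift.{u + 1} Bool, BaireProperty (f ⁻¹' {η | η x.1 = x.2.down}) :=
    fun x => (hf _ (isOpen_setOf_apply_eq hκ _ _)).baireProperty hκ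
  choose U hU hfU using h
  refine ⟨_, Comeager.iInter hκ ?_ hfU, fun η hη γ => ?_⟩
  · rw [mk_prod, mk_below, Cardinal.lift_id, Cardinal.lift_id]
    have hω : ℵ₀ ≤ lift.{u + 1} κ := by simpa using hκ
    exact mul_le_of_le hω le_rfl ((lt_aleph0_of_finite _).le.trans hω)
  · rw [mem_iInter] at hη
    obtain ⟨a, ha⟩ := hU (γ, ⟨f η γ⟩) η ((hη (γ, ⟨f η γ⟩)).1 rfl)
    refine ⟨a, fun ξ hξ hξa => ?_⟩
    rw [mem_iInter] at hξ
    exact (hξ (γ, ⟨f η γ⟩)).2 (ha hξa)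

/-! ### `E0`-invariance and category -/

theorem E0.trans {η ξ ζ : Cantor κ} (h : E0 κ η ξ) (h' : E0 κ ξ ζ) : E0 κ η ζ :=
  (BddAbove.union h h').mono fun α hα => by
    by_contra hc
    simp only [mem_union, mem_ofPred_eq, not_or, not_not] at hc
    exact hα (hc.1.trans hc.2)

/-- The set of points whose whole `E_0`-class lies in a comeager set is comeager. -/
theorem Comeager.setOf_E0_class (hpow : κ ^< κ = κ) (hκ : ℵ₀ ≤ κ) {A : Set (Cantor κ)}
    (hA : Comeager A) : Comeager {η | ∀ ξ, E0 κ η ξ → ξ ∈ A} := by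
  -- An `E0`-class is an orbit under translation by the points of bounded support, which `r`
  -- enumerates; translations preserve comeagerness.
  obtain ⟨r, hr⟩ := exists_enum_E0 hpow hκ (fun _ => false)
  let T : Cantor κ → Cantor κ → Cantor κ := fun t η γ => xor (η γ) (t γ)
  have hT : ∀ t, Comeager (T t ⁻¹' A) := by
    intro t
    obtain ⟨D, hD, hDA⟩ := hA
    refine ⟨fun i => T t ⁻¹' D i, fun i c => ?_, fun η hη => hDA ?_⟩
    · obtain ⟨d, hd, hdD⟩ := hD i ⟨c.len, T t c.val⟩
      refine ⟨⟨d.len, T t d.val⟩, ⟨hd.1, fun β hβ => ?_⟩, fun η hη => hdD fun β hβ => ?_⟩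
      · have := hd.2 β hβ
        simp only [T] at this ⊢
        simp [this]
      · have := hη β hβ
        simp only [T] at this ⊢
        simp [this]
    · rw [mem_iInter] at hη ⊢
      exact hη
  refine (Comeager.iInter hκ (mk_below κ).le fun i => hT (r i)).mono fun η hη ξ hξ => ?_
  rw [mem_iInter] at hη
  obtain ⟨i, hi⟩ := hr (T η ξ) (BddAbove.mono (fun γ hγ => by
    simp only [T, mem_ofPred_eq, ne_eq] at hγ ⊢
    intro h
    simp [h] at hγ) hξ)
  have := hη i
  rw [hi, mem_preimage] at this
  have e : T (T η ξ) η = ξ := funext fun γ => by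
    simp only [T]
    cases η γ <;> simp
  rwa [e] at this

theorem hasDenseInterior_compl_singleton (hκ : ℵ₀ ≤ κ) (x : Cantor κ) :
    HasDenseInterior ({x}ᶜ : Set (Cantor κ)) := by
  classical
  have := noMaxOrder_below hκ
  intro c
  obtain ⟨a, ha⟩ := exists_gt c.len
  refine ⟨⟨a, fun γ => if γ = c.len then !x γ else c.val γ⟩,
    Cond.mk_le (fun β hβ => by simp [hβ.ne]) ha.le, fun η hη hx => ?_⟩
  have h := hη c.len ha
  rw [mem_singleton_iff.1 hx] at h
  simp at h

/-- A function whose fibres lie in `E_0`-classes takes `E_0`-inequivalent values on any two basic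
open sets. -/
theorem exists_not_E0_of_comeager (hκ : κ.IsRegular) (hpow : κ ^< κ = κ) {D : Set (Cantor κ)}
    (hD : Comeager D) {f : Cantor κ → Cantor κ} (hf : ∀ η ξ, f η = f ξ → E0 κ η ξ)
    (c d : Cond κ) :
    ∃ η ∈ D, η ∈ c.nbhd ∧ ∃ ξ ∈ D, ξ ∈ d.nbhd ∧ ¬ E0 κ (f η) (f ξ) := by
  by_contra! h
  have hω := hκ.aleph0_le
  obtain ⟨η, hηD, hη⟩ := hD.exists_mem_nbhd hκ c
  obtain ⟨r, hr⟩ := exists_enum_E0 hpow hω (f η)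
  choose t ht using exists_enum_E0 hpow hω
  have hne : Nonempty (Cantor κ) := ⟨η⟩
  -- Under `h`, `f` maps `D ∩ d.nbhd` into one `E0`-class, enumerated by `r`. Each fibre lies in an
  -- `E0`-class, so removing these `κ · κ` points removes every candidate for `ξ`.
  have hC : Comeager (⋂ i, ⋂ j, ({t (Function.invFun f (r i)) j}ᶜ : Set (Cantor κ))) :=
    Comeager.iInter hω (mk_below κ).le fun i => Comeager.iInter hω (mk_below κ).le fun j =>
      (hasDenseInterior_compl_singleton hω _).comeager hω
  obtain ⟨ξ, ⟨hξD, hξC⟩, hξ⟩ := (hD.inter hω hC).exists_mem_nbhd hκ d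
  obtain ⟨i, hi⟩ := hr _ (h η hηD hη ξ hξD hξ)
  obtain ⟨j, hj⟩ := ht (Function.invFun f (r i)) ξ
    (hf _ _ ((Function.invFun_eq ⟨ξ, hi.symm⟩).trans hi))
  exact mem_iInter.1 (mem_iInter.1 hξC i) j hj.symm

/-! ### Splitting pairs of conditions -/

/-- The pair of conditions `q` decides, on `D`, that `f η △ f ξ` is not constant on the interval
from `a` to the length of `q`. -/
def Splits (D : Set (Cantor κ)) (f : Cantor κ → Cantor κ) (a : Below κ) (q : Cond κ × Cond κ) :
    Prop :=
  ∃ γ γ' : Below κ, a < γ ∧ γ < q.1.len ∧ a < γ' ∧ γ' < q.1.len ∧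
    ∀ η ∈ D, η ∈ q.1.nbhd → ∀ ξ ∈ D, ξ ∈ q.2.nbhd → f η γ ≠ f ξ γ ∧ f η γ' = f ξ γ'

theorem Splits.lt_len {D : Set (Cantor κ)} {f : Cantor κ → Cantor κ} {a : Below κ}
    {q : Cond κ × Cond κ} (h : Splits D f a q) : a < q.1.len :=
  let ⟨_, _, h1, h2, _⟩ := h
  h1.trans h2

theorem exists_le_forall_apply_eq {D : Set (Cantor κ)} {f : Cantor κ → Cantor κ}
    (hcont : ∀ η ∈ D, ∀ γ, ∃ a, ∀ ξ ∈ D, ξ ∈ (⟨a, η⟩ : Cond κ).nbhd → f ξ γ = f η γ)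
    {η : Cantor κ} (hη : η ∈ D) {c : Cond κ} (hc : η ∈ c.nbhd) (γ : Below κ) :
    ∃ d ≤ c, ∀ ξ ∈ D, ξ ∈ d.nbhd → f ξ γ = f η γ := by
  obtain ⟨a, ha⟩ := hcont η hη γ
  exact ⟨⟨max a c.len, η⟩, Cond.mk_le hc (le_max_right _ _), fun ξ hξ hξa => ha ξ hξ fun β hβ =>
    hξa β (hβ.trans_le (le_max_left a c.len))⟩

open Classical in
/-- Two conditions have points in an `E_0`-invariant comeager set that are equivalent. -/
theorem exists_E0_of_comeager (hκ : κ.IsRegular) {D : Set (Cantor κ)} (hD : Comeager D)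
    (hinv : ∀ η ∈ D, ∀ ξ, E0 κ η ξ → ξ ∈ D) (c d : Cond κ) :
    ∃ η ∈ D, η ∈ c.nbhd ∧ ∃ ξ ∈ D, ξ ∈ d.nbhd ∧ E0 κ η ξ := by
  obtain ⟨η, hη, hηc⟩ := hD.exists_mem_nbhd hκ c
  have h : E0 κ η fun γ => if γ < d.len then d.val γ else η γ :=
    ⟨d.len, fun γ hγ => by
      by_contra hlt
      simp [not_lt_of_ge (le_of_not_ge hlt)] at hγ⟩
  exact ⟨η, hη, hηc, _, hinv η hη _ h, fun β hβ => by simp [hβ], h⟩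

theorem exists_le_splits (hκ : κ.IsRegular) (hpow : κ ^< κ = κ) {D : Set (Cantor κ)}
    (hD : Comeager D) (hinv : ∀ η ∈ D, ∀ ξ, E0 κ η ξ → ξ ∈ D) {f : Cantor κ → Cantor κ}
    (hcont : ∀ η ∈ D, ∀ γ, ∃ a, ∀ ξ ∈ D, ξ ∈ (⟨a, η⟩ : Cond κ).nbhd → f ξ γ = f η γ)
    (hinj : ∀ η ξ, f η = f ξ → E0 κ η ξ) (hE : ∀ η ξ, E0 κ η ξ → E0 κ (f η) (f ξ))
    (a : Below κ) (p : Cond κ × Cond κ) : ∃ q ≤ p, Splits D f a q := by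
  have := noMaxOrder_below hκ.aleph0_le
  obtain ⟨η, hη, hηc, ξ, hξ, hξd, hne⟩ := exists_not_E0_of_comeager hκ hpow hD hinj p.1 p.2
  obtain ⟨γ, hγ, haγ⟩ := not_bddAbove_iff.1 hne a
  obtain ⟨c, hc, hcγ⟩ := exists_le_forall_apply_eq hcont hη hηc γ
  obtain ⟨d, hd, hdγ⟩ := exists_le_forall_apply_eq hcont hξ hξd γ
  -- The new points are taken inside `c` and `d`, which keeps the disagreement at `γ` decided.
  obtain ⟨η', hη', hηc', ξ', hξ', hξd', he⟩ := exists_E0_of_comeager hκ hD hinv c d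
  obtain ⟨b, hb⟩ := hE _ _ he
  obtain ⟨γ', hγ'⟩ := exists_gt (max a b)
  have heq : f η' γ' = f ξ' γ' := by
    by_contra h
    exact (hb h).not_gt ((le_max_right _ _).trans_lt hγ')
  obtain ⟨c', hc', hcγ'⟩ := exists_le_forall_apply_eq hcont hη' hηc' γ'
  obtain ⟨d', hd', hdγ'⟩ := exists_le_forall_apply_eq hcont hξ' hξd' γ'
  -- Lengthening the first condition past `γ` and `γ'` keeps both places below the answer of player
  -- II.
  obtain ⟨l, hl⟩ := exists_gt (max γ γ')
  have hle : (⟨max l c'.len, c'.val⟩ : Cond κ) ≤ c' :=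
    Cond.mk_le c'.val_mem_nbhd (le_max_right _ _)
  refine ⟨(⟨max l c'.len, c'.val⟩, d'), ⟨hle.trans (hc'.trans hc), hd'.trans hd⟩, γ, γ', haγ,
    ((le_max_left _ _).trans_lt hl).trans_le (le_max_left _ _), (le_max_left _ _).trans_lt hγ',
    ((le_max_right _ _).trans_lt hl).trans_le (le_max_left _ _), fun x hx hxc y hy hyd => ?_⟩
  have hxc' := Cond.nbhd_subset hle hxc
  refine ⟨?_, ?_⟩
  · rw [hcγ x hx (Cond.nbhd_subset hc' hxc'), hdγ y hy (Cond.nbhd_subset hd' hyd)]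
    exact hγ
  · rw [hcγ' x hx hxc', hdγ' y hy hyd, heq]

/-- The intervals holding the split places start at the `α i`, cofinal in `a`, and end by `a`;
equivalent points below `q` would violate `EStar` at `a`. -/
theorem notMem_of_splits (hκ : κ.IsRegular) {D : Set (Cantor κ)} (hD : Comeager D)
    (hinv : ∀ η ∈ D, ∀ ξ, E0 κ η ξ → ξ ∈ D) {f : Cantor κ → Cantor κ} {S : Set (Below κ)}
    (hE : ∀ η ξ, E0 κ η ξ → EStar S (f η) (f ξ)) {ι : Type*} [Nonempty ι] {α : ι → Below κ}
    {s : ι → Cond κ × Cond κ} {a : Below κ} (hα : IsLUB (range α) a)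
    (hsplit : ∀ i, Splits D f (α i) (s i)) (hlen : ∀ i, (s i).1.len ≤ a)
    (hs : ∃ q, ∀ i, q ≤ s i) : a ∉ S := by
  intro haS
  obtain ⟨q, hq⟩ := hs
  have hlt : ∀ i, α i < a := fun i => (hsplit i).lt_len.trans_le (hlen i)
  have hlim : Order.IsSuccLimit (a : Ordinal.{u}) := by
    refine ⟨fun h => ?_, fun b hb => ?_⟩
    · have i : ι := Classical.arbitrary ι
      exact (h.not_lt (b := ((α i : Below κ) : Ordinal.{u}))) (hlt i)
    · obtain ⟨_, ⟨i, rfl⟩, hi⟩ :=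
        (lt_isLUB_iff hα).1 (show (⟨b, hb.lt.trans a.2⟩ : Below κ) < a from hb.lt)
      exact hb.2 (c := ((α i : Below κ) : Ordinal.{u})) hi (hlt i)
  obtain ⟨η, hη, hηq, ξ, hξ, hξq, he⟩ := exists_E0_of_comeager hκ hD hinv q.1 q.2
  obtain ⟨β, hβ, b, hb⟩ := hE η ξ he a haS hlim
  obtain ⟨_, ⟨i, rfl⟩, hi⟩ := (lt_isLUB_iff hα).1 hβ
  obtain ⟨γ, γ', h1, h2, h3, h4, h⟩ := hsplit i
  obtain ⟨h5, h6⟩ := h η hη (Cond.nbhd_subset (hq i).1 hηq) ξ hξ (Cond.nbhd_subset (hq i).2 hξq)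
  have e1 := hb γ (hi.trans h1) (h2.trans_le (hlen i))
  have e2 := hb γ' (hi.trans h3) (h4.trans_le (hlen i))
  rw [h6, Bool.xor_self] at e2
  rw [← e2] at e1
  exact h5 (by simpa using e1)

/-! ### The game of length `λ` -/

open Classical in
/-- Player II wins `GC_λ(κ \ S)` when conditions can be refined to splitting ones. -/
theorem exists_isWinning_compl (hκ : κ.IsRegular) {D : Set (Cantor κ)} (hD : Comeager D)
    (hinv : ∀ η ∈ D, ∀ ξ, E0 κ η ξ → ξ ∈ D) {f : Cantor κ → Cantor κ} {S : Set (Below κ)}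
    (hE : ∀ η ξ, E0 κ η ξ → EStar S (f η) (f ξ)) {F : Below κ → Cond κ × Cond κ → Cond κ × Cond κ}
    (hF : ∀ a p, F a p ≤ p) (hFs : ∀ a p, Splits D f a (F a p)) (p₀ : Cond κ × Cond κ)
    {lam : Cardinal.{u}} (hlam : lam.IsRegular) (hlt : lam < κ) :
    ∃ σ : Strategy κ lam, IsWinning Sᶜ σ := by
  have := noMaxOrder_below hlam.aleph0_le
  have := nonempty_below hlam.aleph0_le
  -- Moves after `i` are still unknown; the filler value is harmless by `chain_congr`.
  let extend : (i : Below lam) → (Iic i → Below κ) → Below lam → Below κ := fun i α j =>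
    if h : j ≤ i then α ⟨j, h⟩ else p₀.1.len
  refine ⟨fun i α _ => (chain p₀ (fun j => F (extend i α j)) i).1.len, fun α β hβ hleg => ?_⟩
  set s := chain p₀ fun j => F (α j) with hs
  have hβ' : ∀ i, β i = (s i).1.len := fun i => by
    rw [hβ i, hs]
    dsimp only
    rw [chain_congr p₀ i fun j hj => ?_]
    simp only [extend, dif_pos hj]
  have hspec := chain_spec (p₀ := p₀) (F := fun j => F (α j)) (fun i => hF (α i))
    (fun i t ht hp => by
      by_cases hne : Nonempty (Iio i)
      · obtain ⟨q, hq⟩ := exists_pair_le_of_antitone (bddAbove_range_of_mk_lt hκ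
          ((mk_Iio_below i).trans (lift_lt.2 hlt))) ht
        exact ⟨q, (hq hne.some).trans (hp hne.some), hq⟩
      · exact ⟨p₀, le_rfl, fun j => (hne ⟨j⟩).elim⟩)
  have hb : ∀ g : Below lam → Below κ, BddAbove (range g) :=
    bddAbove_range_of_mk_lt hκ (by rw [mk_below]; exact lift_lt.2 hlt)
  have hsplit : ∀ i, Splits D f (α i) (s i) := fun i => by
    obtain ⟨p, hp⟩ := (hspec i).2.2
    rw [hs, hp]
    exact hFs _ _
  obtain ⟨a, ha⟩ := exists_isLUB_of_bddAbove (hb α)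
  refine ⟨fun i => by rw [hβ' i]; exact (hsplit i).lt_len, a, ?_, ha⟩
  refine notMem_of_splits hκ hD hinv hE ha hsplit (fun i => ?_)
    (exists_pair_le_of_antitone hb (antitone_of_forall_lt fun i => (hspec i).2.1))
  -- The length at stage `i` is II's move, which the next moves of I exceed.
  obtain ⟨j, hj⟩ := exists_gt i
  rw [← hβ' i]
  exact (hleg j i hj).2.le.trans (ha.1 (mem_range_self j))

/-! ### The case `λ = ω` -/

/-- The limits of `ω`-sequences that are closed under a function of finite sequences form an
`ω`-cub set. -/
theorem isLamCub_setOf_closed (hκ : κ.IsRegular) (hω : ℵ₀ < κ) (g : List (Below κ) → Below κ) :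
    IsLamCub ℵ₀ {a | (∃ c : ℕ → Below κ, StrictMono c ∧ IsLUB (range c) a) ∧
      ∀ l : List (Below κ), (∀ x ∈ l, x < a) → g l < a} := by
  have := noMaxOrder_below hω.le
  have hlist : ∀ {c : ℕ → Below κ} {a : Below κ}, StrictMono c → IsLUB (range c) a →
      ∀ l : List (Below κ), (∀ x ∈ l, x < a) → ∃ n, ∀ x ∈ l, x < c n := by
    intro c a hc ha l
    induction l with
    | nil => exact fun _ => ⟨0, by simp⟩
    | cons y l ih =>
      intro h
      obtain ⟨n, hn⟩ := ih fun x hx => h x (List.mem_cons_of_mem _ hx)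
      obtain ⟨_, ⟨m, rfl⟩, hm⟩ := (lt_isLUB_iff ha).1 (h y List.mem_cons_self)
      refine ⟨max n m, fun x hx => ?_⟩
      rcases List.mem_cons.1 hx with rfl | hx
      · exact hm.trans_le (hc.monotone (le_max_right _ _))
      · exact (hn x hx).trans_le (hc.monotone (le_max_left _ _))
  refine ⟨fun c hc hcC => ?_, ?_⟩
  · let e : ℕ → Below ℵ₀ := fun n => ⟨n, by simp⟩
    have he : StrictMono e := fun m n h => by
      have h' : (m : Ordinal.{u}) < n := by exact_mod_cast h
      exact h'
    have hsurj : Function.Surjective e := by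
      rintro ⟨x, hx⟩
      rw [mem_Iio, ord_aleph0, Ordinal.lt_omega0] at hx
      obtain ⟨n, rfl⟩ := hx
      exact ⟨n, rfl⟩
    obtain ⟨a, ha⟩ := exists_isLUB_of_bddAbove (bddAbove_range_nat hκ hω (c ∘ e))
    refine ⟨a, ⟨⟨c ∘ e, hc.comp he, ha⟩, fun l hl => ?_⟩, by rwa [hsurj.range_comp] at ha⟩
    obtain ⟨n, hn⟩ := hlist (hc.comp he) ha l hl
    exact ((hcC (e n)).2 l hn).trans_le (ha.1 ⟨n, rfl⟩)
  · rw [not_bddAbove_iff]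
    intro b
    have hstep : ∀ b : Below κ, ∃ b' > b, ∀ l : List (Below κ), (∀ x ∈ l, x < b) → g l < b' := by
      intro b
      -- There are fewer than `κ` finite lists below `b`, so their values under `g` are bounded.
      have hcard : #(List (Iio b)) < lift.{u + 1} κ :=
        (mk_list_le_max _).trans_lt (max_lt (by simpa using hω) (mk_Iio_below b))
      obtain ⟨d, hd⟩ := bddAbove_range_of_mk_lt hκ hcard fun l => g (l.map Subtype.val)
      obtain ⟨b', hb'⟩ := exists_gt (max b d)
      refine ⟨b', (le_max_left _ _).trans_lt hb', fun l hl => ?_⟩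
      have : g l ≤ d := by
        lift l to List (Iio b) using hl
        exact hd ⟨l, rfl⟩
      exact this.trans_lt ((le_max_right _ _).trans_lt hb')
    choose h hh hg using hstep
    let c : ℕ → Below κ := fun n => h^[n] b
    have hsucc : ∀ n, c (n + 1) = h (c n) := fun n => Function.iterate_succ_apply' h n b
    have hc : StrictMono c := strictMono_nat_of_lt_succ fun n => by rw [hsucc]; exact hh _
    obtain ⟨a, ha⟩ := exists_isLUB_of_bddAbove (bddAbove_range_nat hκ hω c)
    refine ⟨a, ⟨⟨c, hc, ha⟩, fun l hl => ?_⟩, (hc Nat.zero_lt_one).trans_le (ha.1 ⟨1, rfl⟩)⟩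
    obtain ⟨n, hn⟩ := hlist hc ha l hl
    refine (hg (c n) l hn).trans_le ?_
    rw [← hsucc]
    exact ha.1 ⟨n + 1, rfl⟩

/-- The complement of `S` contains an `ω`-cub set when conditions can be refined to splitting
ones. -/
theorem exists_isLamCub_subset_compl (hκ : κ.IsRegular) (hω : ℵ₀ < κ) {D : Set (Cantor κ)}
    (hD : Comeager D) (hinv : ∀ η ∈ D, ∀ ξ, E0 κ η ξ → ξ ∈ D) {f : Cantor κ → Cantor κ}
    {S : Set (Below κ)} (hE : ∀ η ξ, E0 κ η ξ → EStar S (f η) (f ξ))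
    {F : Below κ → Cond κ × Cond κ → Cond κ × Cond κ}
    (hF : ∀ a p, F a p ≤ p) (hFs : ∀ a p, Splits D f a (F a p)) (p₀ : Cond κ × Cond κ) :
    ∃ C : Set (Below κ), IsLamCub ℵ₀ C ∧ C ⊆ Sᶜ := by
  refine ⟨_, isLamCub_setOf_closed hκ hω fun l => (l.foldr F p₀).1.len, ?_⟩
  rintro a ⟨⟨c, hc, ha⟩, hcl⟩
  -- Finite lists of moves of I, latest first. Taking the maximum with `c k` makes the moves cofinal
  -- in `a`; closure of `a` keeps them below it.
  let play : ℕ → List (Below κ) :=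
    fun n => n.rec [] fun k l => max (c k) (l.foldr F p₀).1.len :: l
  have hplay : ∀ n, ∀ x ∈ play n, x < a := by
    intro n
    induction n with
    | zero => simp [play]
    | succ k ih =>
      intro x hx
      rcases List.mem_cons.1 hx with rfl | hx
      · exact max_lt ((hc k.lt_succ_self).trans_le (ha.1 ⟨k + 1, rfl⟩)) (hcl _ ih)
      · exact ih x hx
  let state : ℕ → Cond κ × Cond κ := fun n => (play n).foldr F p₀
  let α : ℕ → Below κ := fun n => max (c n) (state n).1.len
  have hstate : ∀ n, state (n + 1) = F (α n) (state n) := fun n => rfl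
  have hanti : Antitone fun n => state (n + 1) :=
    antitone_nat_of_succ_le fun n => by rw [hstate (n + 1)]; exact hF _ _
  have hα : IsLUB (range α) a := by
    refine ⟨?_, fun b hb => ha.2 ?_⟩
    · rintro _ ⟨n, rfl⟩
      exact (hplay (n + 1) _ List.mem_cons_self).le
    · rintro _ ⟨n, rfl⟩
      exact (le_max_left _ _).trans (hb ⟨n, rfl⟩)
  exact notMem_of_splits hκ hD hinv hE hα (s := fun n => state (n + 1))
    (fun n => by rw [hstate]; exact hFs _ _) (fun n => (hcl _ (hplay (n + 1))).le)
    (exists_pair_le_of_antitone (bddAbove_range_nat hκ hω) hanti)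

end GenBaire

open GenBaire in
theorem corollary28 (κ : Cardinal.{u}) (hκ : ℵ₀ < κ) (hpow : κ ^< κ = κ) :
    (∀ lam : Cardinal.{u}, lam.IsRegular → lam < κ → GenBaire.GCCharacterization κ lam →
      ∀ S : Set (GenBaire.Below κ), GenBaire.IsLamStationary lam S →
        ¬ GenBaire.BorelReducible (GenBaire.E0 κ) (GenBaire.ES S)) ∧
    (∀ S : Set (GenBaire.Below κ), GenBaire.IsLamStationary ℵ₀ S →
      ¬ GenBaire.BorelReducible (GenBaire.E0 κ) (GenBaire.ES S)) := by
  have hreg := isRegular_of_powerlt_eq hκ hpow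
  have key : ∀ S : Set (Below κ), BorelReducible (E0 κ) (ES S) →
      (∀ lam : Cardinal.{u}, lam.IsRegular → lam < κ → ∃ σ : Strategy κ lam, IsWinning Sᶜ σ) ∧
        ∃ C : Set (Below κ), IsLamCub ℵ₀ C ∧ C ⊆ Sᶜ := by
    rintro S ⟨f, hf, hred⟩
    obtain ⟨A, hA, hcont⟩ := hf.exists_comeager hκ.le
    have hrefl : ∀ η : Cantor κ, E0 κ η η := fun η => by
      have := nonempty_below hκ.le
      simp [E0]
    have hinj : ∀ η ξ, f η = f ξ → E0 κ η ξ := fun η ξ h => by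
      rw [hred, ← h, ← hred]
      exact hrefl η
    have hDA : ∀ η, (∀ ξ, E0 κ η ξ → ξ ∈ A) → η ∈ A := fun η h => h η (hrefl η)
    have hD := hA.setOf_E0_class hpow hκ.le
    have hinv : ∀ η ∈ {η | ∀ ξ, E0 κ η ξ → ξ ∈ A}, ∀ ξ, E0 κ η ξ →
        ξ ∈ {η | ∀ ξ, E0 κ η ξ → ξ ∈ A} := fun η hη ξ h ζ hζ => hη ζ (h.trans hζ)
    have hcont' : ∀ η ∈ {η | ∀ ξ, E0 κ η ξ → ξ ∈ A}, ∀ γ, ∃ a,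
        ∀ ξ ∈ {η | ∀ ξ, E0 κ η ξ → ξ ∈ A}, ξ ∈ (⟨a, η⟩ : Cond κ).nbhd → f ξ γ = f η γ :=
      fun η hη γ =>
        let ⟨a, ha⟩ := hcont η (hDA η hη) γ
        ⟨a, fun ξ hξ => ha ξ (hDA ξ hξ)⟩
    have hstar : ∀ η ξ, E0 κ η ξ → EStar S (f η) (f ξ) := fun η ξ h => ((hred η ξ).1 h).1
    choose F hF hFs using exists_le_splits hreg hpow hD hinv hcont' hinj
      fun η ξ h => ((hred η ξ).1 h).2
    have p : Cond κ := ⟨(nonempty_below hκ.le).some, fun _ => true⟩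
    exact ⟨fun lam hlam hlt =>
      exists_isWinning_compl hreg hD hinv hstar hF hFs (p, p) hlam hlt,
      exists_isLamCub_subset_compl hreg hκ hD hinv hstar hF hFs (p, p)⟩
  have no_cub : ∀ {lam : Cardinal.{u}} {S C : Set (Below κ)}, IsLamStationary lam S →
      IsLamCub lam C → C ⊆ Sᶜ → False := fun hS hC hCS =>
    let ⟨_, h1, h2⟩ := hS _ hC
    hCS h2 h1
  refine ⟨fun lam hlam hlt hGC S hS hE => ?_, fun S hS hE => ?_⟩
  · obtain ⟨C, hC, hCS⟩ := hGC.subset ((key S hE).1 lam hlam hlt)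
    exact no_cub hS hC hCS
  · obtain ⟨C, hC, hCS⟩ := (key S hE).2
    exact no_cub hS hC hCS
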